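/- Equip $\mathbb{R}^2$ with the Euclidean norm, let $S^1$ be its unit circle, and for $e\in S^1$ let $\pi_e$ be the orthogonal projection onto the line $\mathrm{span}(e)$. For $t,C>0$, a Borel measure $\mu$ on $\mathbb{R}^2$ is called $(t,C)$-Ahlfors–David regular (AD regular) if its support $\mathrm{spt}\,\mu$ has more than one point and $$ r^t/C\le \mu(B(x,r))\le C r^t\qquad\text{for all } x\in \mathrm{spt}\,\mu \text{ and } 0<r\le \mathrm{diam}(\mathrm{spt}\,\mu),$$ where $B(x,r)$ is the closed ball. A set $E\subseteq\mathbb{R}^2$ is called $(t,C)$-AD regular if there is a $(t,C)$-AD regular measure $\mu$ on $E$, i.e. one with $\mu(\mathbb{R}^2\setminus E)=0$. For a nonempty bounded set $F$ let $N(F,\delta)$ be the smallest number of sets of diameter at most $\delta$ that cover $F$, and let $$\overline{\dim}_B F=\limsup_{\delta\to 0^+}\frac{\log N(F,\delta)}{-\log\delta}$$ be its upper box dimension. **Theorem.** For any $0<s<t\le 1$ and $C>0$ there exists a finite set $\Omega\subset S^1$ such that for every $(t,C)$-AD regular set $E\subseteq[0,1)^2$, $$\max_{e\in\Omega}\ \overline{\dim}_B\,\pi_e(E)\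 \ge\ s .$$ -/

import Mathlib

open MeasureTheory Filter Topology

/-- The plane `ℝ²` with its Euclidean norm. -/
abbrev Plane : Type := EuclideanSpace ℝ (Fin 2)

/-- The half-open unit square `[0,1)²`. -/
def unitSquare : Set Plane := {x | ∀ i, x i ∈ Set.Ico (0 : ℝ) 1}

/-- A Borel measure `μ` is `(t, C)`-Ahlfors-David regular if
`r ^ t / C ≤ μ (B(x, r)) ≤ C * r ^ t` for all `x ∈ spt μ` and `0 < r ≤ diam (spt μ)`.
The support is required to have more than one point: otherwise there is no admissible radius, and
the zero measure and point masses would satisfy the condition for every `t`. -/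
structure IsADRegularMeasure {X : Type*} [MetricSpace X] [MeasurableSpace X]
    (t C : ℝ) (μ : Measure X) : Prop where
  nontrivial_support : μ.support.Nontrivial
  bounds : ∀ x ∈ μ.support, ∀ r : ℝ, 0 < r → ENNReal.ofReal r ≤ Metric.ediam μ.support →
    ENNReal.ofReal (r ^ t / C) ≤ μ (Metric.closedBall x r) ∧
      μ (Metric.closedBall x r) ≤ ENNReal.ofReal (C * r ^ t)

/-- A set `E` is `(t, C)`-Ahlfors-David regular if there is a `(t, C)`-Ahlfors-David regular
measure on `E`, that is, one for which the complement of `E` is a null set. -/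
def IsADRegularSet {X : Type*} [MetricSpace X] [MeasurableSpace X] (t C : ℝ) (E : Set X) : Prop :=
  ∃ μ : Measure X, μ Eᶜ = 0 ∧ IsADRegularMeasure t C μ

/-- `N(F, δ)`: the smallest number of sets of diameter at most `δ` that cover `F`
(meaningful when `F` has such a finite cover, e.g. for `δ > 0` and `F` bounded in `ℝᵈ`). -/
noncomputable def boxCoveringNumber {X : Type*} [MetricSpace X] (F : Set X) (δ : ℝ) : ℕ :=
  sInf {k : ℕ | ∃ U : Fin k → Set X,
    F ⊆ ⋃ i, U i ∧ ∀ i, Metric.ediam (U i) ≤ ENNReal.ofReal δ}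

/-- The upper box dimension `limsup_{δ → 0+} log N(F, δ) / (-log δ)` of a nonempty bounded
set `F ⊆ ℝᵈ`, the upper limit being taken in the extended reals. -/
noncomputable def upperBoxDim {X : Type*} [MetricSpace X] (F : Set X) : EReal :=
  limsup (fun δ : ℝ => ((Real.log (boxCoveringNumber F δ) / (-Real.log δ) : ℝ) : EReal)) (𝓝[>] 0)

/-- The orthogonal projection `π_e` of the plane onto the line spanned by `e`. -/
noncomputable def lineProj (e : Plane) : Plane → Plane :=
  fun x => (Submodule.span ℝ {e}).starProjection x

/-! Take the slopes `j / 2 ^ L`, `j < 2 ^ L`, with `L` large depending only on `s`, `t`, `C`, and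
view `E` at the scales `d / (2 ^ L) ^ k`, where `d` is the diameter of the support. The grid squares
form a tree with probability weights on its leaves. A set of small diameter in one projection
collects leaves lying in a common strip at every scale at once. Weighting each leaf by the product
over levels of (mass of its square) / (mass of the part of that square in the strip around the leaf)
gives each such family total weight at most 1. Hence `N` covering sets bound the total weight by
`N`, and Jensen turns this into a lower bound for `log N` that is a sum over levels
(`sum_log_blockMass_div_stripMass_le_log`).

Each level can now be averaged over the slopes separately. As in Marstrand's theorem, two points at
distance about `2 ^ i` grid units share a strip for only a proportion `O(2 ^ (-i))` of the slopes.
Since `t ≤ 1`, a ball of that radius has mass at most a constant times `2 ^ i` times the mass scale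
of one cell, so each dyadic distance contributes equally and the mean strip mass exceeds the cell
mass scale only by a factor `O(L + 1)` (`sum_stripMass_le`). The entropy of a level is controlled by
counting occupied squares (`card_image_mul_le`).

A level thus gains `t * L * log 2` and loses only `O(log L)`, which is at most half of `(t - s) * L
* log 2` for large `L`. At every scale some slope reaches the average. There are finitely many
slopes, so one of them does so at infinitely many scales, which is enough for the upper box
dimension. -/

/-! ### Weighted trees, strips and entropy. -/

/-- The total weight of the block of the partition `g` that contains `a`. -/
noncomputable def blockMass {ι α : Type*} [Fintype ι] (p : ι → ℝ) (g : ι → α) (a : ι) : ℝ :=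
  open Classical in ∑ b with g b = g a, p b

/-- The total weight of those elements of the `g`-block of `a` whose `h`-label is `R`-related to
that of `a`. -/
noncomputable def stripMass {ι α β : Type*} [Fintype ι] (p : ι → ℝ) (g : ι → α) (h : ι → β)
    (R : β → β → Prop) (a : ι) : ℝ :=
  open Classical in ∑ b with g b = g a ∧ R (h a) (h b), p b

section Tree

variable {ι α β : Type*} [Fintype ι] {p : ι → ℝ}

theorem blockMass_pos (hp : ∀ a, 0 < p a) (g : ι → α) (a : ι) : 0 < blockMass p g a := by
  classical
  exact Finset.sum_pos (fun b _ => hp b) ⟨a, by simp⟩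

theorem stripMass_pos (hp : ∀ a, 0 < p a) (g : ι → α) (h : ι → β) {R : β → β → Prop}
    (hR : ∀ u, R u u) (a : ι) : 0 < stripMass p g h R a := by
  classical
  exact Finset.sum_pos (fun b _ => hp b) ⟨a, by simp [hR]⟩

theorem blockMass_congr (g : ι → α) {a b : ι} (hab : g a = g b) :
    blockMass p g a = blockMass p g b := by
  unfold blockMass
  rw [hab]

theorem stripMass_congr (g : ι → α) (h : ι → β) (R : β → β → Prop) {a b : ι} (hab : g a = g b)
    (hab' : h a = h b) : stripMass p g h R a = stripMass p g h R b := by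
  unfold stripMass
  rw [hab, hab']

theorem eq_of_le_of_eq {ι α : Type*} {f : ℕ → ι → α} (hf : ∀ k a b, f (k + 1) a = f (k + 1) b → f k a = f k b)
    {j k : ℕ} (hjk : j ≤ k) {a b : ι} (h : f k a = f k b) : f j a = f j b := by
  induction k, hjk using Nat.le_induction with
  | base => exact h
  | succ k _ ih => exact ih (hf k a b h)

/-- If `w` is constant on the blocks of `g`, then passing from `g` to a refinement `h` and
multiplying by the inverse of the conditional strip mass does not increase the total weight of
a family of pairwise related labels. -/
theorem sum_mul_blockMass_div_stripMass_le (hp : ∀ a, 0 < p a) {g : ι → α} {h : ι → β}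
    {R : β → β → Prop} (hgh : ∀ a b, h a = h b → g a = g b) {V : Set ι}
    (hV : ∀ a ∈ V, ∀ b ∈ V, R (h a) (h b)) {w : ι → ℝ} (hw : ∀ a, 0 ≤ w a)
    (hwg : ∀ a b, g a = g b → w a = w b) [DecidablePred fun a => ∃ v ∈ V, h v = h a]
    [DecidablePred fun a => ∃ v ∈ V, g v = g a] :
    ∑ a with ∃ v ∈ V, h v = h a, p a * (w a * (blockMass p g a / stripMass p g h R a)) ≤
      ∑ a with ∃ v ∈ V, g v = g a, p a * w a := by
  classical
  set A : Finset ι := Finset.univ.filter fun a => ∃ v ∈ V, h v = h a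
  set B : Finset ι := Finset.univ.filter fun a => ∃ v ∈ V, g v = g a
  have hAB : ∀ a ∈ A, g a ∈ B.image g := by
    intro a ha
    obtain ⟨v, hv, hva⟩ := (Finset.mem_filter.1 ha).2
    exact Finset.mem_image_of_mem g (Finset.mem_filter.2 ⟨Finset.mem_univ _, v, hv, hgh _ _ hva⟩)
  rw [← Finset.sum_fiberwise_of_maps_to hAB,
    ← Finset.sum_fiberwise_of_maps_to (fun a ha => Finset.mem_image_of_mem g ha)]
  refine Finset.sum_le_sum fun c hc => ?_
  obtain ⟨a₀, ha₀, rfl⟩ := Finset.mem_image.1 hc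
  obtain ⟨v₀, hv₀, hva₀⟩ := (Finset.mem_filter.1 ha₀).2
  set F := A.filter fun a => g a = g a₀
  -- All labels met by `V` inside one `g`-block are related, so the strip around any one of them
  -- contains all of `F`.
  have hle : ∀ a ∈ F, ∑ b ∈ F, p b ≤ stripMass p g h R a := by
    intro a ha
    obtain ⟨ha1, ha2⟩ := Finset.mem_filter.1 ha
    obtain ⟨v, hv, hva⟩ := (Finset.mem_filter.1 ha1).2
    refine Finset.sum_le_sum_of_subset_of_nonneg (fun b hb => ?_) fun b _ _ => (hp b).le
    obtain ⟨hb1, hb2⟩ := Finset.mem_filter.1 hb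
    obtain ⟨u, hu, hub⟩ := (Finset.mem_filter.1 hb1).2
    refine Finset.mem_filter.2 ⟨Finset.mem_univ _, hb2.trans ha2.symm, ?_⟩
    rw [← hva, ← hub]
    exact hV v hv u hu
  have hsum : ∑ a ∈ F, p a / stripMass p g h R a ≤ 1 := by
    rcases F.eq_empty_or_nonempty with hF | hF
    · simp [hF]
    · have hpos : 0 < ∑ b ∈ F, p b := Finset.sum_pos (fun b _ => hp b) hF
      calc ∑ a ∈ F, p a / stripMass p g h R a ≤ ∑ a ∈ F, p a / ∑ b ∈ F, p b :=
            Finset.sum_le_sum fun a ha =>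
              div_le_div_of_nonneg_left (hp a).le hpos (hle a ha)
        _ = 1 := by rw [← Finset.sum_div, div_self hpos.ne']
  calc ∑ a ∈ F, p a * (w a * (blockMass p g a / stripMass p g h R a))
      = ∑ a ∈ F, (w a₀ * blockMass p g a₀) * (p a / stripMass p g h R a) := by
        refine Finset.sum_congr rfl fun a ha => ?_
        have ha2 := (Finset.mem_filter.1 ha).2
        rw [hwg a a₀ ha2, blockMass_congr g ha2]
        ring
    _ ≤ w a₀ * blockMass p g a₀ := by
        rw [← Finset.mul_sum]
        exact mul_le_of_le_one_right (mul_nonneg (hw a₀) (blockMass_pos hp g a₀).le) hsum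
    _ = ∑ a ∈ B with g a = g a₀, p a * w a := by
        have hF : (B.filter fun a => g a = g a₀) = Finset.univ.filter fun a => g a = g a₀ := by
          ext a
          simp only [B, Finset.mem_filter, Finset.mem_univ, true_and, and_iff_right_iff_imp]
          exact fun ha => ⟨v₀, hv₀, hva₀.trans ha.symm⟩
        rw [hF, blockMass, mul_comm, Finset.sum_mul]
        refine Finset.sum_congr rfl fun a ha => ?_
        rw [hwg a a₀ (Finset.mem_filter.1 ha).2]

/-- Refining one level at a time never increases the weighted mass, so a family related at all
levels keeps weight at most the total mass. -/
theorem sum_mul_prod_blockMass_div_stripMass_le (hp : ∀ a, 0 < p a) {f : ℕ → ι → α}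
    {R : α → α → Prop} (hR : ∀ u, R u u)
    (hf : ∀ k a b, f (k + 1) a = f (k + 1) b → f k a = f k b) {V : Set ι} (n : ℕ)
    (hV : ∀ a ∈ V, ∀ b ∈ V, ∀ k < n, R (f (k + 1) a) (f (k + 1) b)) [DecidablePred (· ∈ V)] :
    ∑ a with a ∈ V, p a * ∏ k ∈ Finset.range n,
      (blockMass p (f k) a / stripMass p (f k) (f (k + 1)) R a) ≤ ∑ a, p a := by
  classical
  have hnn : ∀ k a, 0 ≤ ∏ j ∈ Finset.range k,
      (blockMass p (f j) a / stripMass p (f j) (f (j + 1)) R a) := fun k a =>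
    Finset.prod_nonneg fun j _ =>
      div_nonneg (blockMass_pos hp _ a).le (stripMass_pos hp _ _ hR a).le
  have key : ∀ k ≤ n, ∑ a with ∃ v ∈ V, f k v = f k a, p a * ∏ j ∈ Finset.range k,
      (blockMass p (f j) a / stripMass p (f j) (f (j + 1)) R a) ≤ ∑ a, p a := by
    intro k
    induction k with
    | zero =>
      intro _
      simp only [Finset.range_zero, Finset.prod_empty, mul_one]
      exact Finset.sum_le_sum_of_subset_of_nonneg (Finset.subset_univ _) fun b _ _ => (hp b).le
    | succ k ih =>
      intro hk
      refine le_trans ?_ (ih (by omega))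
      simp only [Finset.prod_range_succ]
      -- The factors already present involve labels of level at most `k` only, hence are constant on
      -- the blocks of `f k`.
      refine sum_mul_blockMass_div_stripMass_le hp (hf k)
        (fun a ha b hb => hV a ha b hb k (by omega)) (hnn k) fun a b hab => ?_
      refine Finset.prod_congr rfl fun j hj => ?_
      have hj' := Finset.mem_range.1 hj
      rw [blockMass_congr _ (eq_of_le_of_eq hf hj'.le hab),
        stripMass_congr _ _ R (eq_of_le_of_eq hf hj'.le hab) (eq_of_le_of_eq hf hj' hab)]
  refine le_trans (Finset.sum_le_sum_of_subset_of_nonneg (fun a ha => ?_) fun a _ _ =>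
    mul_nonneg (hp a).le (hnn n a)) (key n le_rfl)
  exact Finset.mem_filter.2 ⟨Finset.mem_univ _, a, (Finset.mem_filter.1 ha).2, rfl⟩

/-- Jensen's inequality for the logarithm and a probability vector. -/
theorem sum_mul_log_le_log_sum (hp : ∀ a, 0 < p a) (hp1 : ∑ a, p a = 1) {w : ι → ℝ}
    (hw : ∀ a, 0 < w a) : ∑ a, p a * Real.log (w a) ≤ Real.log (∑ a, p a * w a) := by
  simpa using strictConcaveOn_log_Ioi.concaveOn.le_map_sum (t := Finset.univ) (w := p) (p := w)
    (fun a _ => (hp a).le) hp1 fun a _ => hw a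

/-- If the leaves are covered by `N` families that are pairwise related at all levels up to `n`,
then the sum of the conditional log-masses is at most `log N`. -/
theorem sum_log_blockMass_div_stripMass_le_log (hp : ∀ a, 0 < p a) (hp1 : ∑ a, p a = 1)
    {f : ℕ → ι → α} {R : α → α → Prop} (hR : ∀ u, R u u)
    (hf : ∀ k a b, f (k + 1) a = f (k + 1) b → f k a = f k b) (n N : ℕ) (V : Fin N → Set ι)
    (hcov : ∀ a, ∃ i, a ∈ V i)
    (hV : ∀ i, ∀ a ∈ V i, ∀ b ∈ V i, ∀ k < n, R (f (k + 1) a) (f (k + 1) b)) :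
    ∑ k ∈ Finset.range n, ∑ a, p a * (Real.log (blockMass p (f k) a) -
      Real.log (stripMass p (f k) (f (k + 1)) R a)) ≤ Real.log N := by
  classical
  set w : ι → ℝ := fun a => ∏ k ∈ Finset.range n,
    (blockMass p (f k) a / stripMass p (f k) (f (k + 1)) R a)
  have hdiv : ∀ k a, 0 < blockMass p (f k) a / stripMass p (f k) (f (k + 1)) R a := fun k a =>
    div_pos (blockMass_pos hp _ a) (stripMass_pos hp _ _ hR a)
  have hw : ∀ a, 0 < w a := fun a => Finset.prod_pos fun k _ => hdiv k a
  have hne : (Finset.univ : Finset ι).Nonempty := by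
    by_contra h
    simp [Finset.not_nonempty_iff_eq_empty.1 h] at hp1
  have hN : ∑ a, p a * w a ≤ N := by
    calc ∑ a, p a * w a ≤ ∑ a, ∑ i, if a ∈ V i then p a * w a else 0 := by
          refine Finset.sum_le_sum fun a _ => ?_
          obtain ⟨i, hi⟩ := hcov a
          have hnn := (mul_pos (hp a) (hw a)).le
          have := Finset.single_le_sum (f := fun i => if a ∈ V i then p a * w a else 0)
            (fun i _ => by split_ifs <;> [exact hnn; exact le_rfl]) (Finset.mem_univ i)
          simpa [hi] using this
      _ = ∑ i, ∑ a with a ∈ V i, p a * w a := by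
          rw [Finset.sum_comm]
          simp only [Finset.sum_filter]
      _ ≤ ∑ i : Fin N, (1 : ℝ) := Finset.sum_le_sum fun i _ =>
          (sum_mul_prod_blockMass_div_stripMass_le hp hR hf n (hV i)).trans hp1.le
      _ = N := by simp
  refine le_trans ?_ (Real.log_le_log (Finset.sum_pos (fun a _ => mul_pos (hp a) (hw a)) hne) hN)
  refine le_trans (le_of_eq ?_) (sum_mul_log_le_log_sum hp hp1 hw)
  rw [Finset.sum_comm]
  refine Finset.sum_congr rfl fun a _ => ?_
  rw [Real.log_prod fun k _ => (hdiv k a).ne', Finset.mul_sum]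
  refine Finset.sum_congr rfl fun k _ => ?_
  rw [Real.log_div (blockMass_pos hp _ a).ne' (stripMass_pos hp _ _ hR a).ne']

/-- The entropy of a partition is at most the logarithm of the number of its blocks. -/
theorem neg_log_card_le_sum_mul_log_blockMass [DecidableEq α] (hp : ∀ a, 0 < p a)
    (hp1 : ∑ a, p a = 1) (g : ι → α) :
    -Real.log (Finset.univ.image g).card ≤ ∑ a, p a * Real.log (blockMass p g a) := by
  have h := sum_mul_log_le_log_sum hp hp1 (w := fun a => (blockMass p g a)⁻¹)
    fun a => inv_pos.2 (blockMass_pos hp g a)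
  have hcard : ∑ a, p a * (blockMass p g a)⁻¹ = (Finset.univ.image g).card := by
    rw [← Finset.sum_fiberwise_of_maps_to (t := Finset.univ.image g) (g := g)
      (fun a ha => Finset.mem_image_of_mem g ha), Finset.card_eq_sum_ones, Nat.cast_sum]
    refine Finset.sum_congr rfl fun c hc => ?_
    obtain ⟨a₀, -, rfl⟩ := Finset.mem_image.1 hc
    have hsum : ∑ a with g a = g a₀, p a = blockMass p g a₀ := by
      unfold blockMass
      congr
    rw [Nat.cast_one, ← mul_inv_cancel₀ (blockMass_pos hp g a₀).ne', ← hsum, Finset.sum_mul, hsum]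
    refine Finset.sum_congr rfl fun a ha => ?_
    rw [blockMass_congr g (Finset.mem_filter.1 ha).2]
  simp only [Real.log_inv, mul_neg, Finset.sum_neg_distrib, hcard] at h
  linarith

/-- Averaging over the relations `R j`: if on average the strips have mass at most `T`, then
the average of the logarithms is at most `log T`. -/
theorem sum_log_stripMass_le {M : ℕ} (hM : 0 < M) (hp : ∀ a, 0 < p a) (g : ι → α) (h : ι → β)
    {R : ℕ → β → β → Prop} (hR : ∀ j u, R j u u) {T : ℝ} (a : ι)
    (hT : ∑ j ∈ Finset.range M, stripMass p g h (R j) a ≤ M * T) :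
    ∑ j ∈ Finset.range M, Real.log (stripMass p g h (R j) a) ≤ M * Real.log T := by
  have hM' : (0 : ℝ) < M := Nat.cast_pos.2 hM
  have hpos : ∀ j, 0 < stripMass p g h (R j) a := fun j => stripMass_pos hp g h (hR j) a
  have hJ := strictConcaveOn_log_Ioi.concaveOn.le_map_sum (t := Finset.range M)
    (w := fun _ => (M : ℝ)⁻¹) (p := fun j => stripMass p g h (R j) a)
    (fun j _ => (inv_pos.2 hM').le) (by simp [hM'.ne']) fun j _ => hpos j
  simp only [smul_eq_mul, ← Finset.mul_sum] at hJ
  have h2 : Real.log ((M : ℝ)⁻¹ * ∑ j ∈ Finset.range M, stripMass p g h (R j) a) ≤ Real.log T := by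
    refine Real.log_le_log (mul_pos (inv_pos.2 hM')
      (Finset.sum_pos (fun j _ => hpos j) (Finset.nonempty_range_iff.2 hM.ne'))) ?_
    rwa [inv_mul_le_iff₀ hM']
  have h3 := hJ.trans h2
  rwa [inv_mul_le_iff₀ hM'] at h3

end Tree

/-! ### Lattice points in common strips. -/

theorem card_le_add_one_of_sub_le {S : Finset ℕ} {X : ℝ} (hX : 0 ≤ X)
    (h : ∀ a ∈ S, ∀ b ∈ S, (b : ℝ) - a ≤ X) : (S.card : ℝ) ≤ X + 1 := by
  rcases S.eq_empty_or_nonempty with rfl | hS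
  · simpa using by linarith
  · have hsub : S ⊆ Finset.Icc (S.min' hS) (S.max' hS) := fun a ha =>
      Finset.mem_Icc.2 ⟨S.min'_le a ha, S.le_max' a ha⟩
    have hc := Finset.card_le_card hsub
    rw [Nat.card_Icc] at hc
    have hle : S.min' hS ≤ S.max' hS := S.min'_le _ (S.max'_mem hS)
    have h1 := h _ (S.min'_mem hS) _ (S.max'_mem hS)
    have h2 : (S.card : ℝ) + S.min' hS ≤ S.max' hS + 1 := by
      exact_mod_cast (by omega : S.card + S.min' hS ≤ S.max' hS + 1)
    linarith

/-- Both coordinates of `u` and `v` differ by at most `r`. -/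
def LatticeNear (r : ℤ) (u v : ℤ × ℤ) : Prop := |u.1 - v.1| ≤ r ∧ |u.2 - v.2| ≤ r

/-- The projections of `u` and `v` in the direction `(1, σ)` differ by at most `4`. -/
def StripNear (σ : ℝ) (u v : ℤ × ℤ) : Prop :=
  |((u.1 - v.1 : ℤ) : ℝ) + σ * ((u.2 - v.2 : ℤ) : ℝ)| ≤ 4

theorem StripNear.refl (σ : ℝ) (u : ℤ × ℤ) : StripNear σ u u := by simp [StripNear]

/-- Two lattice points at distance about `2 ^ i` lie in a common strip of width `8` for a
proportion of at most `34 / 2 ^ i` of the slopes `j / 2 ^ L`. -/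
theorem exists_latticeNear_and_card_stripNear_le (L : ℕ) (u v : ℤ × ℤ)
    (huv : LatticeNear (2 ^ L) u v) [∀ j : ℕ, Decidable (StripNear (j / 2 ^ L) u v)] :
    ∃ i ≤ L, LatticeNear (2 ^ i) u v ∧
      (((Finset.range (2 ^ L)).filter fun j : ℕ => StripNear (j / 2 ^ L) u v).card : ℝ) * 2 ^ i ≤
        34 * 2 ^ L := by
  classical
  have hex : ∃ i, LatticeNear (2 ^ i) u v := ⟨L, huv⟩
  -- Minimality of `i` makes `2 ^ i` comparable to the sup-distance of `u` and `v`.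
  obtain ⟨i, hi, hmin⟩ : ∃ i, LatticeNear (2 ^ i) u v ∧ ∀ k < i, ¬ LatticeNear (2 ^ k) u v :=
    ⟨Nat.find hex, Nat.find_spec hex, fun k hk => Nat.find_min hex hk⟩
  have hiL : i ≤ L := by
    by_contra h
    exact hmin L (by omega) huv
  refine ⟨i, hiL, hi, ?_⟩
  set S := (Finset.range (2 ^ L)).filter fun j : ℕ => StripNear (j / 2 ^ L) u v
  have hS : (S.card : ℝ) ≤ 2 ^ L := by
    exact_mod_cast (Finset.card_filter_le _ _).trans (Finset.card_range _).le
  have hL : (0 : ℝ) < 2 ^ L := by positivity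
  have hi2 : (2 : ℝ) ^ i ≤ 2 ^ L := pow_le_pow_right₀ (by norm_num) hiL
  rcases le_or_gt ((2 : ℝ) ^ i) 16 with h16 | h16
  · nlinarith
  obtain ⟨k, rfl⟩ : ∃ k, i = k + 1 := by
    refine Nat.exists_eq_succ_of_ne_zero fun h => ?_
    rw [h] at h16
    norm_num at h16
  have hk := hmin k (by omega)
  simp only [LatticeNear, not_and_or, not_le] at hk
  rw [pow_succ] at h16 hi2
  have hk' : (2 : ℝ) ^ k < |((u.1 - v.1 : ℤ) : ℝ)| ∨ (2 : ℝ) ^ k < |((u.2 - v.2 : ℤ) : ℝ)| := by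
    refine hk.imp (fun h => ?_) fun h => ?_ <;> exact_mod_cast h
  rcases S.eq_empty_or_nonempty with hSe | ⟨j₀, hj₀⟩
  · simp [hSe]
  set x : ℝ := ((u.1 - v.1 : ℤ) : ℝ) with hx
  set y : ℝ := ((u.2 - v.2 : ℤ) : ℝ) with hy
  have hst : ∀ j ∈ S, |x + (j / 2 ^ L : ℝ) * y| ≤ 4 := fun j hj => (Finset.mem_filter.1 hj).2
  have hpow : (0 : ℝ) < 2 ^ k := by positivity
  -- One admissible slope already forces the second difference to be large: `|x| ≤ 4 + |y|`, and `2
  -- ^ k > 8`.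
  have hylow : (2 : ℝ) ^ k / 2 ≤ |y| := by
    rcases hk' with h | h
    · have h0 : ((j₀ : ℝ) / 2 ^ L) ≤ 1 := by
        rw [div_le_one hL]
        exact_mod_cast (Finset.mem_range.1 (Finset.mem_filter.1 hj₀).1).le
      have h1 : |x| ≤ |x + (j₀ / 2 ^ L : ℝ) * y| + |(j₀ / 2 ^ L : ℝ) * y| := by
        simpa using abs_sub (x + (j₀ / 2 ^ L : ℝ) * y) ((j₀ / 2 ^ L : ℝ) * y)
      have h2 : |(j₀ / 2 ^ L : ℝ) * y| ≤ |y| := by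
        rw [abs_mul, abs_of_nonneg (by positivity : (0 : ℝ) ≤ j₀ / 2 ^ L)]
        exact mul_le_of_le_one_left (abs_nonneg y) h0
      have h3 := hst j₀ hj₀
      linarith
    · linarith
  have hcard : (S.card : ℝ) ≤ 16 * 2 ^ L / 2 ^ k + 1 := by
    refine card_le_add_one_of_sub_le (by positivity) fun a ha b hb => ?_
    have h1 : |((b : ℝ) - a) / 2 ^ L * y| ≤ 8 := by
      have e : ((b : ℝ) - a) / 2 ^ L * y = (x + b / 2 ^ L * y) - (x + a / 2 ^ L * y) := by ring
      rw [e]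
      exact (abs_sub _ _).trans (by linarith [hst a ha, hst b hb])
    rw [abs_mul, abs_div, abs_of_pos hL, div_mul_eq_mul_div, div_le_iff₀ hL] at h1
    have h2 : |(b : ℝ) - a| * (2 ^ k / 2) ≤ 8 * 2 ^ L :=
      (mul_le_mul_of_nonneg_left hylow (abs_nonneg _)).trans h1
    rw [le_div_iff₀ hpow]
    nlinarith [le_abs_self ((b : ℝ) - a)]
  rw [pow_succ]
  have h4 : (16 * 2 ^ L / 2 ^ k + 1 : ℝ) * (2 ^ k * 2) = 32 * 2 ^ L + 2 ^ k * 2 := by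
    field_simp
    ring
  calc (S.card : ℝ) * (2 ^ k * 2) ≤ (16 * 2 ^ L / 2 ^ k + 1) * (2 ^ k * 2) := by gcongr
    _ ≤ 34 * 2 ^ L := by rw [h4]; linarith

section Discrete

variable {ι : Type*} [Fintype ι] {p : ι → ℝ}

/-- The total weight of the elements whose label differs from that of `a` by at most `r`. -/
noncomputable def nearMass (p : ι → ℝ) (g : ι → ℤ × ℤ) (r : ℤ) (a : ι) : ℝ :=
  open Classical in ∑ b with LatticeNear r (g a) (g b), p b

/-- Exchange the sums over slopes and points and sort the points by dyadic distance. The mass bound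
`2 ^ i * ρ` cancels the proportion `34 / 2 ^ i` of slopes, so all `L + 1` distances contribute
equally. -/
theorem sum_stripMass_le (hp : ∀ a, 0 < p a) {g h : ι → ℤ × ℤ} (L : ℕ)
    (hgh : ∀ a b, g a = g b → LatticeNear (2 ^ L) (h a) (h b)) {ρ : ℝ} (a : ι)
    (hU : ∀ i ≤ L, nearMass p h (2 ^ i) a ≤ 2 ^ i * ρ) :
    ∑ j ∈ Finset.range (2 ^ L), stripMass p g h (StripNear (j / 2 ^ L)) a ≤
      2 ^ L * (34 * (L + 1) * ρ) := by
  classical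
  have hswap : ∑ j ∈ Finset.range (2 ^ L), stripMass p g h (StripNear (j / 2 ^ L)) a =
      ∑ b with g b = g a, p b * ((Finset.range (2 ^ L)).filter
        fun j : ℕ => StripNear (j / 2 ^ L) (h a) (h b)).card := by
    have h1 : ∀ j : ℕ, stripMass p g h (StripNear (j / 2 ^ L)) a =
        ∑ b with g b = g a, if StripNear (j / 2 ^ L) (h a) (h b) then p b else 0 := by
      intro j
      rw [← Finset.sum_filter, Finset.filter_filter, stripMass]
      congr
    rw [Finset.sum_congr rfl fun j _ => h1 j, Finset.sum_comm]
    refine Finset.sum_congr rfl fun b _ => ?_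
    rw [← Finset.sum_filter, Finset.sum_const, nsmul_eq_mul, mul_comm]
  rw [hswap]
  calc ∑ b with g b = g a, p b * ((Finset.range (2 ^ L)).filter
        fun j : ℕ => StripNear (j / 2 ^ L) (h a) (h b)).card
      ≤ ∑ b, ∑ i ∈ Finset.range (L + 1),
          if LatticeNear (2 ^ i) (h a) (h b) then p b * (34 * 2 ^ L / 2 ^ i) else 0 := by
        have hnn : ∀ b i, 0 ≤
            if LatticeNear (2 ^ i) (h a) (h b) then p b * (34 * 2 ^ L / 2 ^ i) else 0 := by
          intro b i
          have := (hp b).le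
          split_ifs <;> positivity
        refine (Finset.sum_le_sum fun b hb => ?_).trans
          (Finset.sum_le_sum_of_subset_of_nonneg (Finset.subset_univ _) fun b _ _ =>
            Finset.sum_nonneg fun i _ => hnn b i)
        obtain ⟨i, hi, hnear, hc⟩ := exists_latticeNear_and_card_stripNear_le L (h a) (h b)
          (hgh a b (Finset.mem_filter.1 hb).2.symm)
        refine le_trans ?_ (Finset.single_le_sum (fun i _ => hnn b i)
          (Finset.mem_range.2 (Nat.lt_succ_of_le hi)))
        rw [if_pos hnear]
        refine mul_le_mul_of_nonneg_left ?_ (hp b).le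
        rwa [le_div_iff₀ (by positivity)]
    _ = ∑ i ∈ Finset.range (L + 1), nearMass p h (2 ^ i) a * (34 * 2 ^ L / 2 ^ i) := by
        rw [Finset.sum_comm]
        refine Finset.sum_congr rfl fun i _ => ?_
        rw [nearMass, Finset.sum_mul, Finset.sum_filter]
    _ ≤ ∑ i ∈ Finset.range (L + 1), 34 * 2 ^ L * ρ := by
        refine Finset.sum_le_sum fun i hi => ?_
        have hi' := hU i (Nat.lt_succ_iff.1 (Finset.mem_range.1 hi))
        calc nearMass p h (2 ^ i) a * (34 * 2 ^ L / 2 ^ i)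
            ≤ 2 ^ i * ρ * (34 * 2 ^ L / 2 ^ i) := by gcongr
          _ = 34 * 2 ^ L * ρ := by field_simp
    _ = 2 ^ L * (34 * (L + 1) * ρ) := by
        rw [Finset.sum_const, Finset.card_range, nsmul_eq_mul]
        push_cast
        ring

/-- The 3 by 3 neighbourhoods of the occupied cells each have mass at least `ρ` and cover every
point at most nine times. -/
theorem card_image_mul_le [DecidableEq (ℤ × ℤ)] (hp : ∀ a, 0 < p a) (hp1 : ∑ a, p a = 1)
    (g : ι → ℤ × ℤ) {ρ : ℝ} (hρ : ∀ a, ρ ≤ nearMass p g 1 a) :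
    (Finset.univ.image g).card * ρ ≤ 9 := by
  classical
  set D : Finset (ℤ × ℤ) := Finset.Icc (-1) 1 ×ˢ Finset.Icc (-1) 1
  calc (Finset.univ.image g).card * ρ = ∑ c ∈ Finset.univ.image g, ρ := by simp
    _ ≤ ∑ c ∈ Finset.univ.image g, ∑ z ∈ D, ∑ b, if g b = c + z then p b else 0 := by
        refine Finset.sum_le_sum fun c hc => ?_
        obtain ⟨a, -, rfl⟩ := Finset.mem_image.1 hc
        refine (hρ a).trans ?_
        rw [nearMass, Finset.sum_filter, Finset.sum_comm]
        refine Finset.sum_le_sum fun b _ => ?_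
        have hnn : ∀ z, 0 ≤ if g b = g a + z then p b else 0 := by
          intro z
          split_ifs <;> [exact (hp b).le; exact le_rfl]
        split_ifs with hab
        · have hz : g b - g a ∈ D := by
            obtain ⟨h1, h2⟩ := hab
            rw [abs_le] at h1 h2
            simp only [D, Finset.mem_product, Finset.mem_Icc, Prod.fst_sub, Prod.snd_sub]
            omega
          refine le_trans (le_of_eq ?_) (Finset.single_le_sum (fun z _ => hnn z) hz)
          simp
        · exact Finset.sum_nonneg fun z _ => hnn z
    _ ≤ ∑ z ∈ D, (1 : ℝ) := by
        rw [Finset.sum_comm]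
        refine Finset.sum_le_sum fun z _ => ?_
        rw [Finset.sum_comm, ← hp1]
        refine Finset.sum_le_sum fun b _ => ?_
        simp only [← sub_eq_iff_eq_add]
        rw [Finset.sum_ite_eq]
        split_ifs <;> [exact le_rfl; exact (hp b).le]
    _ = 9 := by
        rw [Finset.sum_const, nsmul_eq_mul, mul_one]
        have : D.card = 9 := by decide
        exact_mod_cast this

/-- The discrete form of the projection theorem: a labelled tree with regular branching has,
on average over the slopes, covering numbers at least as large as the tree itself, up to a
factor that is logarithmic in the branching number at each level. -/
theorem le_sum_log_of_regular_tree [Nonempty ι] (hp : ∀ a, 0 < p a) (hp1 : ∑ a, p a = 1)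
    {f : ℕ → ι → ℤ × ℤ} (hf : ∀ k a b, f (k + 1) a = f (k + 1) b → f k a = f k b) (L n : ℕ)
    (hfL : ∀ k a b, f k a = f k b → LatticeNear (2 ^ L) (f (k + 1) a) (f (k + 1) b))
    {ρ : ℕ → ℝ} (hρ : ∀ k, 0 < ρ k) {A B : ℝ} (hA : 0 < A) (hB : 0 < B)
    (hU : ∀ k < n, ∀ a, ∀ i ≤ L, nearMass p (f (k + 1)) (2 ^ i) a ≤ 2 ^ i * (A * ρ (k + 1)))
    (hlow : ∀ k < n, ∀ a, ρ k / B ≤ nearMass p (f k) 1 a)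
    (N : ℕ → ℕ) (V : ∀ j, Fin (N j) → Set ι) (hcov : ∀ j < 2 ^ L, ∀ a, ∃ i, a ∈ V j i)
    (hV : ∀ j < 2 ^ L, ∀ i, ∀ a ∈ V j i, ∀ b ∈ V j i, ∀ k < n,
      StripNear (j / 2 ^ L) (f (k + 1) a) (f (k + 1) b)) :
    2 ^ L * (Real.log (ρ 0) - Real.log (ρ n) - n * Real.log (9 * B * (34 * (L + 1) * A))) ≤
      ∑ j ∈ Finset.range (2 ^ L), Real.log (N j) := by
  classical
  set K : ℝ := 34 * (L + 1) * A with hK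
  have hK0 : 0 < K := by positivity
  -- Entropy gives `log (ρ k)` and the averaged strips give `log (ρ (k + 1))`, up to constants; the
  -- difference telescopes over the levels.
  have hlevel : ∀ k < n, 2 ^ L * (Real.log (ρ k) - Real.log (ρ (k + 1)) - Real.log (9 * B * K)) ≤
      ∑ j ∈ Finset.range (2 ^ L), ∑ a, p a * (Real.log (blockMass p (f k) a) -
        Real.log (stripMass p (f k) (f (k + 1)) (StripNear (j / 2 ^ L)) a)) := by
    intro k hk
    have hent := neg_log_card_le_sum_mul_log_blockMass hp hp1 (f k)
    have hc := card_image_mul_le hp hp1 (f k) (hlow k hk)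
    have hcpos : (0 : ℝ) < (Finset.univ.image (f k)).card := by
      exact_mod_cast Finset.card_pos.2 (Finset.univ_nonempty.image _)
    have hc' : Real.log (Finset.univ.image (f k)).card ≤ Real.log (9 * B) - Real.log (ρ k) := by
      rw [← Real.log_div (by positivity) (hρ k).ne']
      refine Real.log_le_log hcpos ?_
      rw [le_div_iff₀ (hρ k)]
      rw [mul_div_assoc', div_le_iff₀ hB] at hc
      linarith
    have hstrip : ∀ a, ∑ j ∈ Finset.range (2 ^ L),
        Real.log (stripMass p (f k) (f (k + 1)) (StripNear (j / 2 ^ L)) a) ≤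
          2 ^ L * (Real.log K + Real.log (ρ (k + 1))) := by
      intro a
      have h1 := sum_stripMass_le hp L (hfL k) a (hU k hk a)
      have h2 := sum_log_stripMass_le (M := 2 ^ L) (by positivity) hp (f k) (f (k + 1))
        (R := fun j => StripNear (j / 2 ^ L)) (fun j u => StripNear.refl _ u)
        (T := K * ρ (k + 1)) a (by
          push_cast
          refine h1.trans (le_of_eq ?_)
          rw [hK]
          ring)
      rw [Real.log_mul hK0.ne' (hρ _).ne'] at h2
      exact_mod_cast h2
    rw [Finset.sum_comm]
    calc 2 ^ L * (Real.log (ρ k) - Real.log (ρ (k + 1)) - Real.log (9 * B * K))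
        ≤ 2 ^ L * (∑ a, p a * Real.log (blockMass p (f k) a) -
            (Real.log K + Real.log (ρ (k + 1)))) := by
          rw [Real.log_mul (by positivity) hK0.ne']
          refine mul_le_mul_of_nonneg_left ?_ (by positivity)
          linarith
      _ = ∑ a, p a * (2 ^ L * Real.log (blockMass p (f k) a) -
            2 ^ L * (Real.log K + Real.log (ρ (k + 1)))) := by
          simp only [mul_sub, Finset.sum_sub_distrib, ← Finset.sum_mul, hp1, one_mul,
            Finset.mul_sum]
          congr 1
          exact Finset.sum_congr rfl fun a _ => by ring
      _ ≤ _ := by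
          refine Finset.sum_le_sum fun a _ => ?_
          rw [← Finset.mul_sum]
          refine mul_le_mul_of_nonneg_left ?_ (hp a).le
          rw [Finset.sum_sub_distrib, Finset.sum_const, Finset.card_range, nsmul_eq_mul]
          push_cast
          linarith [hstrip a]
  have hsum := Finset.sum_le_sum fun k (hk : k ∈ Finset.range n) =>
    hlevel k (Finset.mem_range.1 hk)
  rw [← Finset.mul_sum, Finset.sum_sub_distrib, Finset.sum_range_sub' (fun k => Real.log (ρ k)),
    Finset.sum_const, Finset.card_range, nsmul_eq_mul, Finset.sum_comm] at hsum
  refine hsum.trans (Finset.sum_le_sum fun j hj => ?_)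
  have hj' := Finset.mem_range.1 hj
  exact sum_log_blockMass_div_stripMass_le_log hp hp1 (fun u => StripNear.refl _ u) hf n (N j)
    (V j) (hcov j hj') (hV j hj')

end Discrete

/-! ### Finite samples and covers. -/

/-- One point of `G` is chosen in each cell of `c` of positive measure, weighted by the normalized
mass of the cell. Null cells are dropped, so that logarithms of weights make sense. -/
theorem exists_finite_sample {X α : Type*} [MeasurableSpace X] [MeasurableSpace α]
    [MeasurableSingletonClass α] {μ : Measure X} [IsFiniteMeasure μ] (hμ : μ ≠ 0) {c : X → α}
    (hc : Measurable c) {G : Set X} (hG : μ Gᶜ = 0) (hfin : (c '' G).Finite) :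
    ∃ (S : Finset α) (x : S → X) (p : S → ℝ), (∀ a, x a ∈ G) ∧ (∀ a, 0 < p a) ∧ ∑ a, p a = 1 ∧
      ∀ Q : Set X, (∀ y z, c y = c z → y ∈ Q → z ∈ Q) → ∀ [DecidablePred fun a => x a ∈ Q],
        ∑ a with x a ∈ Q, p a = μ.real Q / μ.real Set.univ := by
  classical
  set S : Finset α := hfin.toFinset.filter fun u => 0 < μ.real (c ⁻¹' {u}) with hS
  have hM : 0 < μ.real Set.univ := by
    rw [measureReal_def, ENNReal.toReal_pos_iff]
    exact ⟨Measure.measure_univ_pos.2 hμ, measure_lt_top _ _⟩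
  have hpos : ∀ u ∈ S, 0 < μ.real (c ⁻¹' {u}) := fun u hu => (Finset.mem_filter.1 hu).2
  have hex : ∀ a : S, ∃ y ∈ G, c y = a := by
    intro a
    by_contra! h
    have hsub : c ⁻¹' {a.1} ⊆ Gᶜ := fun y hy hyG => h y hyG hy
    have h0 := measure_mono_null hsub hG
    have := hpos a a.2
    simp [measureReal_def, h0] at this
  choose x hxG hxc using hex
  have hnull : μ (c ⁻¹' (S : Set α))ᶜ = 0 := by
    have hsub : (c ⁻¹' (S : Set α))ᶜ ⊆
        Gᶜ ∪ ⋃ u ∈ hfin.toFinset.filter fun u => ¬ 0 < μ.real (c ⁻¹' {u}), c ⁻¹' {u} := by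
      intro y hy
      by_cases hyG : y ∈ G
      · right
        have h1 : c y ∈ hfin.toFinset := hfin.mem_toFinset.2 ⟨y, hyG, rfl⟩
        simp only [Set.mem_iUnion]
        refine ⟨c y, Finset.mem_filter.2 ⟨h1, fun h => hy ?_⟩, rfl⟩
        exact Finset.mem_coe.2 (Finset.mem_filter.2 ⟨h1, h⟩)
      · exact Or.inl hyG
    refine measure_mono_null hsub (measure_union_null hG ?_)
    refine (measure_biUnion_null_iff (Finset.countable_toSet _)).2 fun u hu => ?_
    have h1 := (Finset.mem_filter.1 hu).2
    have h2 : μ.real (c ⁻¹' {u}) = 0 := le_antisymm (not_lt.1 h1) measureReal_nonneg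
    rwa [measureReal_def, ENNReal.toReal_eq_zero_iff, or_iff_left (measure_ne_top _ _)] at h2
  have key : ∀ Q : Set X, (∀ y z, c y = c z → y ∈ Q → z ∈ Q) →
      ∀ [DecidablePred fun a => x a ∈ Q],
      ∑ a with x a ∈ Q, μ.real (c ⁻¹' {a.1}) / μ.real Set.univ = μ.real Q / μ.real Set.univ := by
    intro Q hQ _
    have hiff : ∀ a : S, x a ∈ Q ↔ a.1 ∈ c '' Q := by
      intro a
      refine ⟨fun h => ⟨x a, h, hxc a⟩, ?_⟩
      rintro ⟨y, hy, hya⟩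
      exact hQ y (x a) (hya.trans (hxc a).symm) hy
    rw [← Finset.sum_div, Finset.sum_filter]
    congr 1
    simp only [hiff]
    rw [Finset.sum_coe_sort S (fun u => if u ∈ c '' Q then μ.real (c ⁻¹' {u}) else 0),
      ← Finset.sum_filter, sum_measureReal_preimage_singleton _ fun u _ =>
        hc (measurableSet_singleton u)]
    refine measureReal_congr (ae_eq_set.2 ⟨?_, ?_⟩)
    · refine measure_mono_null ?_ (measure_empty (μ := μ))
      rintro y ⟨hy, hyQ⟩
      obtain ⟨-, z, hz, hzy⟩ := Finset.mem_filter.1 hy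
      exact hyQ (hQ z y hzy hz)
    · refine measure_mono_null ?_ hnull
      rintro y ⟨hyQ, hy⟩ hyS
      exact hy (Finset.mem_coe.2 (Finset.mem_filter.2 ⟨hyS, y, hyQ, rfl⟩))
  refine ⟨S, x, fun a => μ.real (c ⁻¹' {a.1}) / μ.real Set.univ, hxG,
    fun a => div_pos (hpos a a.2) hM, ?_, key⟩
  have h := key Set.univ (fun _ _ _ _ => Set.mem_univ _)
  simpa [hM.ne'] using h

theorem exists_cover_boxCoveringNumber {X : Type*} [MetricSpace X] {F : Set X}
    (hF : TotallyBounded F) {δ : ℝ} (hδ : 0 < δ) :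
    ∃ U : Fin (boxCoveringNumber F δ) → Set X,
      F ⊆ ⋃ i, U i ∧ ∀ i, Metric.ediam (U i) ≤ ENNReal.ofReal δ := by
  -- The infimum of the empty set would be `0`; total boundedness supplies a finite cover, so the
  -- infimum is attained.
  refine Nat.sInf_mem (s := {k : ℕ | ∃ U : Fin k → Set X,
    F ⊆ ⋃ i, U i ∧ ∀ i, Metric.ediam (U i) ≤ ENNReal.ofReal δ}) ?_
  obtain ⟨T, hT, hcov⟩ := Metric.totallyBounded_iff.1 hF (δ / 2) (by positivity)
  have := hT.fintype
  refine ⟨Fintype.card T, fun i => Metric.ball ((Fintype.equivFin T).symm i : X) (δ / 2),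
    fun y hy => ?_, fun i => ?_⟩
  · obtain ⟨z, hz, hyz⟩ := Set.mem_iUnion₂.1 (hcov hy)
    exact Set.mem_iUnion.2 ⟨Fintype.equivFin T ⟨z, hz⟩, by simpa using hyz⟩
  · refine Metric.ediam_le fun y hy z hz => ?_
    rw [edist_dist]
    refine ENNReal.ofReal_le_ofReal ?_
    have h1 := dist_triangle_right y z ((Fintype.equivFin T).symm i : X)
    rw [Metric.mem_ball] at hy hz
    linarith

/-! ### Grid squares and projections in the plane. -/

/-- The index of the half-open grid square of side `δ` that contains `x`. -/
noncomputable def gridCode (δ : ℝ) (x : Plane) : ℤ × ℤ := (⌊x 0 / δ⌋, ⌊x 1 / δ⌋)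

theorem measurable_gridCode (δ : ℝ) : Measurable (gridCode δ) := by
  unfold gridCode
  fun_prop

theorem gridCode_eq_of_gridCode_div_eq {δ : ℝ} {m : ℕ} (hm : m ≠ 0) {x y : Plane}
    (h : gridCode (δ / m) x = gridCode (δ / m) y) : gridCode δ x = gridCode δ y := by
  have key : ∀ z : ℝ, ⌊z / δ⌋ = ⌊z / (δ / m)⌋ / m := by
    intro z
    rw [← Int.floor_div_natCast]
    congr 1
    have : (m : ℝ) ≠ 0 := Nat.cast_ne_zero.2 hm
    field_simp
  simp only [gridCode, Prod.mk.injEq] at h ⊢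
  rw [key (x 0), key (x 1), key (y 0), key (y 1), h.1, h.2]
  exact ⟨rfl, rfl⟩

theorem abs_floor_sub_floor_le {a b : ℝ} {r : ℤ} (h : |a - b| ≤ r) : |⌊a⌋ - ⌊b⌋| ≤ r := by
  rw [abs_le] at h ⊢
  constructor
  · have : (⌊b⌋ : ℝ) < ⌊a⌋ + r + 1 := by
      linarith [Int.floor_le b, Int.lt_floor_add_one a]
    have : ⌊b⌋ < ⌊a⌋ + r + 1 := by exact_mod_cast this
    omega
  · have : (⌊a⌋ : ℝ) < ⌊b⌋ + r + 1 := by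
      linarith [Int.floor_le a, Int.lt_floor_add_one b]
    have : ⌊a⌋ < ⌊b⌋ + r + 1 := by exact_mod_cast this
    omega

theorem abs_sub_le_of_abs_floor_sub_floor_le {a b : ℝ} {r : ℤ} (h : |⌊a⌋ - ⌊b⌋| ≤ r) :
    |a - b| ≤ r + 1 := by
  have h' : |(⌊a⌋ : ℝ) - ⌊b⌋| ≤ r := by exact_mod_cast h
  rw [abs_le] at h' ⊢
  constructor <;> linarith [Int.floor_le a, Int.lt_floor_add_one a, Int.floor_le b,
    Int.lt_floor_add_one b]

theorem latticeNear_gridCode {δ : ℝ} (hδ : 0 < δ) {r : ℤ} {x y : Plane}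
    (h : ∀ i, |x i - y i| ≤ r * δ) : LatticeNear r (gridCode δ x) (gridCode δ y) := by
  have key : ∀ i, |x i / δ - y i / δ| ≤ r := by
    intro i
    rw [← sub_div, abs_div, abs_of_pos hδ, div_le_iff₀ hδ]
    exact h i
  exact ⟨abs_floor_sub_floor_le (key 0), abs_floor_sub_floor_le (key 1)⟩

theorem abs_sub_le_of_latticeNear_gridCode {δ : ℝ} (hδ : 0 < δ) {r : ℤ} {x y : Plane}
    (h : LatticeNear r (gridCode δ x) (gridCode δ y)) (i : Fin 2) :
    |x i - y i| ≤ (r + 1) * δ := by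
  have e : |x i - y i| / δ = |x i / δ - y i / δ| := by
    rw [← sub_div, abs_div, abs_of_pos hδ]
  rw [← div_le_iff₀ hδ, e]
  fin_cases i
  · exact abs_sub_le_of_abs_floor_sub_floor_le h.1
  · exact abs_sub_le_of_abs_floor_sub_floor_le h.2

theorem abs_sub_apply_le_dist (x y : Plane) (i : Fin 2) : |x i - y i| ≤ dist x y := by
  rw [dist_eq_norm]
  simpa using PiLp.norm_apply_le (x - y) i

theorem dist_le_abs_add_abs (x y : Plane) : dist x y ≤ |x 0 - y 0| + |x 1 - y 1| := by
  rw [EuclideanSpace.dist_eq, Fin.sum_univ_two]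
  refine Real.sqrt_le_iff.2 ⟨by positivity, ?_⟩
  rw [Real.dist_eq, Real.dist_eq]
  nlinarith [abs_nonneg (x 0 - y 0), abs_nonneg (x 1 - y 1)]

theorem latticeNear_gridCode_of_dist_le {δ : ℝ} (hδ : 0 < δ) {x y : Plane} (h : dist x y ≤ δ) :
    LatticeNear 1 (gridCode δ x) (gridCode δ y) :=
  latticeNear_gridCode hδ fun i => by simpa using (abs_sub_apply_le_dist x y i).trans h

theorem dist_le_of_latticeNear_gridCode {δ : ℝ} (hδ : 0 < δ) {r : ℤ} {x y : Plane}
    (h : LatticeNear r (gridCode δ x) (gridCode δ y)) : dist x y ≤ 2 * (r + 1) * δ := by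
  have h0 := abs_sub_le_of_latticeNear_gridCode hδ h 0
  have h1 := abs_sub_le_of_latticeNear_gridCode hδ h 1
  linarith [dist_le_abs_add_abs x y]

theorem latticeNear_gridCode_div {δ : ℝ} (hδ : 0 < δ) {m : ℕ} (hm : 0 < m) {x y : Plane}
    (h : gridCode δ x = gridCode δ y) :
    LatticeNear m (gridCode (δ / m) x) (gridCode (δ / m) y) := by
  have hm' : (0 : ℝ) < m := Nat.cast_pos.2 hm
  refine latticeNear_gridCode (by positivity) fun i => ?_
  have h0 : LatticeNear 0 (gridCode δ x) (gridCode δ y) := by simp [h, LatticeNear]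
  have h1 := abs_sub_le_of_latticeNear_gridCode hδ h0 i
  simp only [Int.cast_zero, zero_add, one_mul] at h1
  rw [Int.cast_natCast, mul_div_cancel₀ _ hm'.ne']
  exact h1

/-- The unit vector with slope `σ`. -/
noncomputable def slopeVector (σ : ℝ) : Plane := (√(1 + σ ^ 2))⁻¹ • !₂[1, σ]

theorem norm_slopeVector (σ : ℝ) : ‖slopeVector σ‖ = 1 := by
  have h : ‖(!₂[1, σ] : Plane)‖ = √(1 + σ ^ 2) := by
    rw [EuclideanSpace.norm_eq, Fin.sum_univ_two]
    simp
  have hpos : 0 < √(1 + σ ^ 2) := Real.sqrt_pos.2 (by positivity)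
  rw [slopeVector, norm_smul, h, norm_inv, Real.norm_of_nonneg hpos.le, inv_mul_cancel₀ hpos.ne']

theorem abs_add_mul_le_dist_lineProj_slopeVector {σ : ℝ} (h0 : 0 ≤ σ) (h1 : σ ≤ 1)
    (x y : Plane) : |x 0 - y 0 + σ * (x 1 - y 1)| ≤
      2 * dist (lineProj (slopeVector σ) x) (lineProj (slopeVector σ) y) := by
  have hpos : 0 < √(1 + σ ^ 2) := Real.sqrt_pos.2 (by positivity)
  have hle : √(1 + σ ^ 2) ≤ 2 := Real.sqrt_le_iff.2 ⟨by norm_num, by nlinarith⟩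
  have hin : inner ℝ (slopeVector σ) (x - y) =
      (√(1 + σ ^ 2))⁻¹ * (x 0 - y 0 + σ * (x 1 - y 1)) := by
    rw [slopeVector, real_inner_smul_left, PiLp.inner_apply, Fin.sum_univ_two]
    simp only [PiLp.sub_apply, Matrix.cons_val_zero, Matrix.cons_val_one, RCLike.inner_apply,
      conj_trivial]
    ring
  rw [dist_eq_norm, lineProj, lineProj, ← map_sub,
    Submodule.starProjection_unit_singleton ℝ (norm_slopeVector σ), norm_smul, norm_slopeVector,
    mul_one, hin, norm_mul, Real.norm_eq_abs, Real.norm_eq_abs, abs_inv, abs_of_pos hpos,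
    mul_comm (√(1 + σ ^ 2))⁻¹, ← div_eq_mul_inv, mul_div_assoc', le_div_iff₀ hpos]
  nlinarith [abs_nonneg (x 0 - y 0 + σ * (x 1 - y 1))]

/-- The width `4` is `2` from the normalization `√(1 + σ ^ 2) ≤ 2`, plus at most `1` of rounding
error in each coordinate. -/
theorem stripNear_gridCode {σ δ : ℝ} (h0 : 0 ≤ σ) (h1 : σ ≤ 1) (hδ : 0 < δ) {x y : Plane}
    (h : dist (lineProj (slopeVector σ) x) (lineProj (slopeVector σ) y) ≤ δ) :
    StripNear σ (gridCode δ x) (gridCode δ y) := by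
  have h2 : |(x 0 / δ - y 0 / δ) + σ * (x 1 / δ - y 1 / δ)| ≤ 2 := by
    have e : (x 0 / δ - y 0 / δ) + σ * (x 1 / δ - y 1 / δ) =
        (x 0 - y 0 + σ * (x 1 - y 1)) / δ := by ring
    rw [e, abs_div, abs_of_pos hδ, div_le_iff₀ hδ]
    linarith [abs_add_mul_le_dist_lineProj_slopeVector h0 h1 x y]
  simp only [StripNear, gridCode]
  push_cast
  have hfr : ∀ a b : ℝ, |((⌊a⌋ : ℝ) - ⌊b⌋) - (a - b)| ≤ 1 := by
    intro a b
    rw [abs_le]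
    constructor <;> linarith [Int.floor_le a, Int.lt_floor_add_one a, Int.floor_le b,
      Int.lt_floor_add_one b]
  have h3 := hfr (x 0 / δ) (y 0 / δ)
  have h4 := hfr (x 1 / δ) (y 1 / δ)
  have h5 : |σ * (((⌊x 1 / δ⌋ : ℝ) - ⌊y 1 / δ⌋) - (x 1 / δ - y 1 / δ))| ≤ 1 := by
    rw [abs_mul, abs_of_nonneg h0]
    nlinarith [abs_nonneg (((⌊x 1 / δ⌋ : ℝ) - ⌊y 1 / δ⌋) - (x 1 / δ - y 1 / δ))]
  rw [mul_sub] at h5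
  rw [abs_le] at h2 h3 h5 ⊢
  constructor <;> linarith [h2.1, h2.2, h3.1, h3.2, h5.1, h5.2]

/-! ### Mass bounds for regular measures. -/

section Regular

variable {X : Type*} [MetricSpace X] [MeasurableSpace X] {t C : ℝ} {μ : Measure X}

theorem IsADRegularMeasure.diam_pos (h : IsADRegularMeasure t C μ)
    (hb : Bornology.IsBounded μ.support) : 0 < Metric.diam μ.support :=
  Metric.diam_pos h.nontrivial_support hb

theorem IsADRegularMeasure.measure_univ_le [HereditarilyLindelofSpace X]
    (h : IsADRegularMeasure t C μ) (hb : Bornology.IsBounded μ.support) :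
    μ Set.univ ≤ ENNReal.ofReal (C * Metric.diam μ.support ^ t) := by
  obtain ⟨x, hx⟩ := h.nontrivial_support.nonempty
  have h1 := (h.bounds x hx _ (h.diam_pos hb) ENNReal.ofReal_toReal_le).2
  refine le_trans ?_ h1
  calc μ Set.univ ≤ μ (Metric.closedBall x (Metric.diam μ.support) ∪ μ.supportᶜ) := by
        refine measure_mono fun y _ => ?_
        by_cases hy : y ∈ μ.support
        · exact Or.inl (Metric.dist_le_diam_of_mem hb hy hx)
        · exact Or.inr hy
    _ ≤ μ (Metric.closedBall x (Metric.diam μ.support)) + μ μ.supportᶜ := measure_union_le _ _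
    _ = _ := by rw [Measure.measure_compl_support, add_zero]

theorem IsADRegularMeasure.le_measureReal_closedBall [IsFiniteMeasure μ]
    (h : IsADRegularMeasure t C μ) {x : X} (hx : x ∈ μ.support) {r : ℝ} (hr : 0 < r)
    (hrd : r ≤ Metric.diam μ.support) : r ^ t / C ≤ μ.real (Metric.closedBall x r) := by
  have h1 := (h.bounds x hx r hr
    ((ENNReal.ofReal_le_ofReal hrd).trans ENNReal.ofReal_toReal_le)).1
  exact (ENNReal.ofReal_le_iff_le_toReal (measure_ne_top _ _)).1 h1

theorem IsADRegularMeasure.measureReal_univ_le [HereditarilyLindelofSpace X]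
    (h : IsADRegularMeasure t C μ) (hb : Bornology.IsBounded μ.support) (hC : 0 < C) :
    μ.real Set.univ ≤ C * Metric.diam μ.support ^ t :=
  ENNReal.toReal_le_of_le_ofReal
    (mul_nonneg hC.le (Real.rpow_nonneg Metric.diam_nonneg t)) (h.measure_univ_le hb)

theorem IsADRegularMeasure.measureReal_closedBall_le [HereditarilyLindelofSpace X]
    [IsFiniteMeasure μ] (h : IsADRegularMeasure t C μ) (hb : Bornology.IsBounded μ.support)
    (ht : 0 ≤ t) (hC : 0 < C) {x : X} (hx : x ∈ μ.support) {r : ℝ} (hr : 0 < r) :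
    μ.real (Metric.closedBall x r) ≤ C * r ^ t := by
  rcases le_total r (Metric.diam μ.support) with hrd | hrd
  · have h1 := (h.bounds x hx r hr
      ((ENNReal.ofReal_le_ofReal hrd).trans ENNReal.ofReal_toReal_le)).2
    exact ENNReal.toReal_le_of_le_ofReal (by positivity) h1
  · refine (measureReal_mono (Set.subset_univ _)).trans ((h.measureReal_univ_le hb hC).trans ?_)
    gcongr

end Regular

/-! ### From a regular set to a tree. -/

theorem support_subset_closure {X : Type*} [TopologicalSpace X] [MeasurableSpace X]
    {μ : Measure X} {E : Set X} (h : μ Eᶜ = 0) : μ.support ⊆ closure E :=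
  Measure.support_subset_of_isClosed isClosed_closure
    (mem_ae_iff.2 (measure_mono_null (Set.compl_subset_compl.2 subset_closure) h))

theorem isBounded_unitSquare : Bornology.IsBounded unitSquare := by
  refine (Metric.isBounded_iff_subset_closedBall (0 : Plane)).2 ⟨2, fun x hx => ?_⟩
  have h : ∀ i, |x i - (0 : Plane) i| ≤ 1 := by
    intro i
    have := hx i
    simp only [PiLp.zero_apply, sub_zero]
    exact abs_le.2 ⟨by linarith [this.1], this.2.le⟩
  rw [Metric.mem_closedBall]
  linarith [dist_le_abs_add_abs x 0, h 0, h 1]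

theorem finite_image_gridCode {δ : ℝ} (hδ : 0 < δ) {E : Set Plane} (hE : E ⊆ unitSquare) :
    (gridCode δ '' E).Finite := by
  refine ((Set.finite_Icc (0 : ℤ) ⌈1 / δ⌉).prod (Set.finite_Icc (0 : ℤ) ⌈1 / δ⌉)).subset ?_
  have key : ∀ z ∈ Set.Ico (0 : ℝ) 1, ⌊z / δ⌋ ∈ Set.Icc (0 : ℤ) ⌈1 / δ⌉ := by
    intro z hz
    refine ⟨Int.floor_nonneg.2 (div_nonneg hz.1 hδ.le), ?_⟩
    have h1 : z / δ ≤ 1 / δ := by gcongr; exact hz.2.le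
    exact (Int.floor_le_floor h1).trans (Int.floor_le_ceil _)
  rintro _ ⟨x, hx, rfl⟩
  exact ⟨key _ (hE hx 0), key _ (hE hx 1)⟩

theorem totallyBounded_image_lineProj {E : Set Plane} (hE : E ⊆ unitSquare) (e : Plane) :
    TotallyBounded (lineProj e '' E) :=
  ((isBounded_unitSquare.subset hE).isCompact_closure.totallyBounded.subset subset_closure).image
    (Submodule.span ℝ {e}).starProjection.uniformContinuous

theorem gridCode_eq_of_le {d : ℝ} {m : ℕ} (hm : m ≠ 0) {k n : ℕ} (hkn : k ≤ n) {x y : Plane}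
    (h : gridCode (d / m ^ n) x = gridCode (d / m ^ n) y) :
    gridCode (d / m ^ k) x = gridCode (d / m ^ k) y := by
  refine eq_of_le_of_eq (f := fun k x => gridCode (d / m ^ k) x) (fun k a b hab => ?_) hkn h
  refine gridCode_eq_of_gridCode_div_eq hm ?_
  rwa [div_div, ← pow_succ]

/-- The sum over the slopes `j / 2 ^ L` of the logarithmic covering numbers of the projections of
a regular set is at least `2 ^ L` times that of the set, up to a bounded error per scale. -/
theorem le_sum_log_boxCoveringNumber_lineProj {t C : ℝ} (ht0 : 0 < t) (ht : t ≤ 1) (hC : 0 < C)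
    (L : ℕ) {E : Set Plane} (hE : E ⊆ unitSquare) {μ : Measure Plane} (hμE : μ Eᶜ = 0)
    (hμ : IsADRegularMeasure t C μ) (n : ℕ) :
    2 ^ L * (n * (t * (L * Real.log 2) - Real.log (1224 * C ^ 4 * (L + 1)))) ≤
      ∑ j ∈ Finset.range (2 ^ L), Real.log (boxCoveringNumber
        (lineProj (slopeVector (j / 2 ^ L)) '' E) (Metric.diam μ.support / (2 ^ L) ^ n)) := by
  classical
  have hb : Bornology.IsBounded μ.support :=
    (isBounded_unitSquare.subset hE).closure.subset (support_subset_closure hμE)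
  set d := Metric.diam μ.support with hd
  have hd0 : 0 < d := hμ.diam_pos hb
  have : IsFiniteMeasure μ := ⟨(hμ.measure_univ_le hb).trans_lt ENNReal.ofReal_lt_top⟩
  set m : ℕ := 2 ^ L with hm
  have hm0 : 0 < m := by positivity
  have hmR : (0 : ℝ) < m := Nat.cast_pos.2 hm0
  have hm1 : (1 : ℝ) ≤ m := Nat.one_le_cast.2 hm0
  have hmc : (m : ℝ) = 2 ^ L := by rw [hm]; push_cast; rfl
  have hδ : ∀ k : ℕ, 0 < d / (m : ℝ) ^ k := fun k => by positivity
  obtain ⟨x₀, hx₀⟩ := hμ.nontrivial_support.nonempty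
  have hMlow : d ^ t / C ≤ μ.real Set.univ :=
    (hμ.le_measureReal_closedBall hx₀ hd0 le_rfl).trans (measureReal_mono (Set.subset_univ _))
  have hMup : μ.real Set.univ ≤ C * d ^ t := hμ.measureReal_univ_le hb hC
  have hM : 0 < μ.real Set.univ := lt_of_lt_of_le (by positivity) hMlow
  have hμ0 : μ ≠ 0 := by
    rintro rfl
    simp at hM
  -- Sample points must lie in `E`, for the covers of its projections, and in the support, for the
  -- regularity bounds.
  have hG : μ (E ∩ μ.support)ᶜ = 0 := by
    rw [Set.compl_inter]
    exact measure_union_null hμE Measure.measure_compl_support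
  obtain ⟨S, x, p, hxG, hp, hp1, hmass⟩ := exists_finite_sample hμ0
    (measurable_gridCode (d / (m : ℝ) ^ n)) hG
    ((finite_image_gridCode (hδ n) hE).subset (Set.image_mono Set.inter_subset_left))
  have : Nonempty S := by
    by_contra h
    rw [not_nonempty_iff] at h
    simp at hp1
  set f : ℕ → S → ℤ × ℤ := fun k a => gridCode (d / (m : ℝ) ^ k) (x a) with hf
  set ρ : ℕ → ℝ := fun k => (((m : ℝ) ^ k)⁻¹) ^ t with hρdef
  have hρ : ∀ k, 0 < ρ k := fun k => by positivity
  have hdρ : ∀ k, (d / (m : ℝ) ^ k) ^ t = d ^ t * ρ k := fun k => by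
    rw [div_eq_mul_inv, Real.mul_rpow hd0.le (by positivity)]
  have hnear : ∀ k ≤ n, ∀ (r : ℤ) (a : S), nearMass p (f k) r a =
      μ.real {y | LatticeNear r (f k a) (gridCode (d / (m : ℝ) ^ k) y)} / μ.real Set.univ := by
    intro k hk r a
    refine (hmass {y | LatticeNear r (f k a) (gridCode (d / (m : ℝ) ^ k) y)} fun y z hyz hy => ?_)
    have := gridCode_eq_of_le hm0.ne' hk hyz
    simpa only [Set.mem_ofPred_eq, this] using hy
  have hcover := fun j : ℕ => exists_cover_boxCoveringNumber
    (totallyBounded_image_lineProj hE (slopeVector (j / 2 ^ L))) (hδ n)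
  choose U hUcov hUdiam using hcover
  have hδle : ∀ k ≤ n, d / (m : ℝ) ^ n ≤ d / (m : ℝ) ^ k := by
    intro k hk
    gcongr
  -- `A` combines the upper ball bound, with radius factor `4`, and total mass at least `d ^ t / C`;
  -- `B` combines the lower ball bound and total mass at most `C * d ^ t`.
  have hmain := le_sum_log_of_regular_tree hp hp1 (f := f) ?_ L n ?_ hρ (A := 4 * C ^ 2)
    (B := C ^ 2) (by positivity) (by positivity) ?_ ?_
    (fun j => boxCoveringNumber (lineProj (slopeVector (j / 2 ^ L)) '' E) (d / (m : ℝ) ^ n))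
    (fun j i => {a | lineProj (slopeVector (j / 2 ^ L)) (x a) ∈ U j i}) ?_ ?_
  · rw [hmc] at hmain
    refine le_trans (le_of_eq ?_) hmain
    have h0 : Real.log (ρ 0) = 0 := by simp [hρdef]
    have h1 : Real.log (ρ n) = -(n * (t * (L * Real.log 2))) := by
      rw [hρdef]
      dsimp only
      rw [Real.log_rpow (by positivity), Real.log_inv, Real.log_pow, hmc, Real.log_pow]
      ring
    have h2 : 9 * C ^ 2 * (34 * ((L : ℝ) + 1) * (4 * C ^ 2)) = 1224 * C ^ 4 * (L + 1) := by ring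
    rw [h0, h1, h2]
    ring
  · intro k a b hab
    refine gridCode_eq_of_gridCode_div_eq hm0.ne' ?_
    rwa [div_div, ← pow_succ]
  · intro k a b hab
    have := latticeNear_gridCode_div (hδ k) hm0 hab
    rw [div_div, ← pow_succ] at this
    rwa [hm, Nat.cast_pow, Nat.cast_ofNat, ← hm] at this
  · intro k hk a i hi
    rw [hnear (k + 1) hk, div_le_iff₀ hM]
    set δ := d / (m : ℝ) ^ (k + 1)
    have hδ0 : 0 < δ := hδ (k + 1)
    have hsub : {y | LatticeNear (2 ^ i) (f (k + 1) a) (gridCode δ y)} ⊆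
        Metric.closedBall (x a) (4 * 2 ^ i * δ) := by
      intro y hy
      have h1 := dist_le_of_latticeNear_gridCode hδ0 hy
      have h2 : (1 : ℝ) ≤ 2 ^ i := one_le_pow₀ (by norm_num)
      rw [Metric.mem_closedBall, dist_comm]
      refine h1.trans ?_
      push_cast
      exact mul_le_mul_of_nonneg_right (by linarith) hδ0.le
    refine (measureReal_mono hsub).trans
      ((hμ.measureReal_closedBall_le hb ht0.le hC (hxG a).2 (by positivity)).trans ?_)
    -- This is where `t ≤ 1` enters: ball masses grow at most linearly in the radius.
    have h3 : ((4 : ℝ) * 2 ^ i) ^ t ≤ 4 * 2 ^ i := by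
      have h4 : (1 : ℝ) ≤ 2 ^ i := one_le_pow₀ (by norm_num)
      simpa using Real.rpow_le_rpow_of_exponent_le (by linarith : (1 : ℝ) ≤ 4 * 2 ^ i) ht
    rw [Real.mul_rpow (by positivity) hδ0.le, hdρ]
    calc C * ((4 * 2 ^ i) ^ t * (d ^ t * ρ (k + 1)))
        ≤ C * ((4 * 2 ^ i) * (d ^ t * ρ (k + 1))) := by
          have := hρ (k + 1)
          gcongr
      _ = 2 ^ i * (4 * C ^ 2 * ρ (k + 1)) * (d ^ t / C) := by
          field_simp
      _ ≤ 2 ^ i * (4 * C ^ 2 * ρ (k + 1)) * μ.real Set.univ := by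
          have := hρ (k + 1)
          gcongr
  · intro k hk a
    rw [hnear k hk.le, le_div_iff₀ hM]
    have hkd : d / (m : ℝ) ^ k ≤ d := div_le_self hd0.le (one_le_pow₀ hm1)
    refine le_trans ?_ ((hμ.le_measureReal_closedBall (hxG a).2 (hδ k) hkd).trans
      (measureReal_mono fun y hy => ?_))
    · rw [hdρ]
      calc ρ k / C ^ 2 * μ.real Set.univ ≤ ρ k / C ^ 2 * (C * d ^ t) := by
            have := hρ k
            gcongr
        _ = d ^ t * ρ k / C := by field_simp
    · rw [Metric.mem_closedBall, dist_comm] at hy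
      exact latticeNear_gridCode_of_dist_le (hδ k) hy
  · intro j _ a
    obtain ⟨i, hi⟩ := Set.mem_iUnion.1 (hUcov j ⟨x a, (hxG a).1, rfl⟩)
    exact ⟨i, hi⟩
  · intro j hj i a ha b hb' k hk
    have hj0 : (0 : ℝ) ≤ j / 2 ^ L := by positivity
    have hj1 : (j : ℝ) / 2 ^ L ≤ 1 := by
      rw [div_le_one (by positivity)]
      exact_mod_cast hj.le
    refine stripNear_gridCode hj0 hj1 (hδ (k + 1)) ?_
    have h1 := (Metric.edist_le_ediam_of_mem (s := U j i) ha hb').trans (hUdiam j i)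
    rw [edist_dist, ENNReal.ofReal_le_ofReal_iff (hδ n).le] at h1
    -- A cover at the finest scale gives closeness of the projections at every coarser scale.
    exact h1.trans (hδle (k + 1) hk)

/-! ### Choice of the branching number and passage to the dimension. -/

theorem exists_mul_add_one_le_two_rpow (K : ℝ) {ε : ℝ} (hε : 0 < ε) :
    ∃ L : ℕ, 0 < L ∧ K * (L + 1) ≤ (2 : ℝ) ^ (ε * L) := by
  have hr : 1 < (2 : ℝ) ^ ε := Real.one_lt_rpow (by norm_num) hε
  have h1 := tendsto_pow_const_div_const_pow_of_one_lt 1 hr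
  have h2 := tendsto_pow_const_div_const_pow_of_one_lt 0 hr
  have h3 := ((h1.add h2).const_mul K).eventually_le_const (u := 1) (by simp)
  obtain ⟨L, hL, hL0⟩ := (h3.and (eventually_gt_atTop 0)).exists
  refine ⟨L, hL0, ?_⟩
  have hpos : 0 < ((2 : ℝ) ^ ε) ^ L := by positivity
  rw [Real.rpow_mul (by norm_num), Real.rpow_natCast]
  rwa [pow_one, pow_zero, ← add_div, mul_div_assoc', div_le_one hpos] at hL

/-- The gap `s' - s` absorbs the constant `log d` once `n` is large, and a limsup sees any sequence
of scales tending to zero. -/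
theorem le_upperBoxDim_of_frequently {X : Type*} [MetricSpace X] {F : Set X} {s s' d b : ℝ}
    (hd : 0 < d) (hb : 1 < b) (hs : s < s')
    (h : ∃ᶠ n : ℕ in atTop, n * (s' * Real.log b) ≤ Real.log (boxCoveringNumber F (d / b ^ n))) :
    (s : EReal) ≤ upperBoxDim F := by
  have hlogb : 0 < Real.log b := Real.log_pos hb
  have hb0 : 0 < b := by linarith
  have htend : Tendsto (fun n : ℕ => d / b ^ n) atTop (𝓝[>] 0) := by
    refine tendsto_nhdsWithin_iff.2 ⟨?_, Eventually.of_forall fun n => ?_⟩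
    · exact (tendsto_pow_atTop_atTop_of_one_lt hb).const_div_atTop d
    · exact div_pos hd (pow_pos hb0 n)
  refine le_limsup_of_frequently_le (htend.frequently (h.mp ?_))
  have hN : Tendsto (fun n : ℕ => (n : ℝ)) atTop atTop := tendsto_natCast_atTop_atTop
  filter_upwards [hN.eventually_gt_atTop (Real.log d / Real.log b),
    hN.eventually_ge_atTop (-s * Real.log d / ((s' - s) * Real.log b))] with n h1 h2 h3
  rw [div_lt_iff₀ hlogb] at h1
  rw [div_le_iff₀ (mul_pos (sub_pos.2 hs) hlogb)] at h2
  have hlog : -Real.log (d / b ^ n) = n * Real.log b - Real.log d := by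
    rw [Real.log_div hd.ne' (pow_pos hb0 n).ne', Real.log_pow]
    ring
  rw [EReal.coe_le_coe_iff, hlog, le_div_iff₀ (by linarith)]
  linarith

theorem theorem1p1 (s t C : ℝ) (hs : 0 < s) (hst : s < t) (ht : t ≤ 1) (hC : 0 < C) :
    ∃ Ω : Finset Plane, (Ω : Set Plane) ⊆ Metric.sphere 0 1 ∧
      ∀ E : Set Plane, E ⊆ unitSquare → IsADRegularSet t C E →
        ∃ e ∈ Ω, (s : EReal) ≤ upperBoxDim (lineProj e '' E) := by
  classical
  -- The loss per level is at most `(t - s) / 2` in the exponent, leaving `(s + t) / 2 > s`.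
  obtain ⟨L, hL0, hL⟩ := exists_mul_add_one_le_two_rpow (1224 * C ^ 4)
    (ε := (t - s) / 2) (by linarith)
  have hK : (0 : ℝ) < 1224 * C ^ 4 * (L + 1) := by positivity
  have hlogK : Real.log (1224 * C ^ 4 * (L + 1)) ≤ (t - s) / 2 * (L * Real.log 2) := by
    refine (Real.log_le_log hK hL).trans (le_of_eq ?_)
    rw [Real.log_rpow (by norm_num)]
    ring
  refine ⟨(Finset.range (2 ^ L)).image fun j : ℕ => slopeVector (j / 2 ^ L), ?_, ?_⟩
  · intro e he
    obtain ⟨j, -, rfl⟩ := Finset.mem_image.1 (Finset.mem_coe.1 he)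
    simp [norm_slopeVector]
  rintro E hE ⟨μ, hμE, hμ⟩
  have hb : Bornology.IsBounded μ.support :=
    (isBounded_unitSquare.subset hE).closure.subset (support_subset_closure hμE)
  have hex : ∀ n : ℕ, ∃ j ∈ Finset.range (2 ^ L),
      n * ((s + t) / 2 * Real.log (2 ^ L)) ≤ Real.log (boxCoveringNumber
        (lineProj (slopeVector (j / 2 ^ L)) '' E) (Metric.diam μ.support / (2 ^ L) ^ n)) := by
    intro n
    refine Finset.exists_le_of_sum_le (Finset.nonempty_range_iff.2 (by positivity)) (le_trans ?_
      (le_sum_log_boxCoveringNumber_lineProj (hs.trans hst) ht hC L hE hμE hμ n))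
    rw [Finset.sum_const, Finset.card_range, nsmul_eq_mul, Real.log_pow]
    push_cast
    gcongr
    linarith
  -- Pigeonhole: the good slope depends on `n`, but if each slope failed for all large `n`, some `n`
  -- would have no good slope.
  obtain ⟨j, hj, hfreq⟩ : ∃ j ∈ Finset.range (2 ^ L), ∃ᶠ n : ℕ in atTop,
      n * ((s + t) / 2 * Real.log (2 ^ L)) ≤ Real.log (boxCoveringNumber
        (lineProj (slopeVector (j / 2 ^ L)) '' E) (Metric.diam μ.support / (2 ^ L) ^ n)) := by
    by_contra! h
    have h' := (Finset.eventually_all (Finset.range (2 ^ L))).2 h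
    obtain ⟨n, hn⟩ := h'.exists
    obtain ⟨j, hj, hjn⟩ := hex n
    exact (hn j hj).not_ge hjn
  exact ⟨_, Finset.mem_image_of_mem _ hj, le_upperBoxDim_of_frequently (hμ.diam_pos hb)
    (one_lt_pow₀ (by norm_num) hL0.ne') (by linarith) hfreq⟩
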